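/- **Theorem 5 (Markov boundary of stage 1).** *Setting.* Let $V$ be a finite set and let $x_j$, $j\in V$, be variables with values in nonempty standard Borel spaces carrying $\sigma$-finite reference measures (for instance $\mathbb R$ with Lebesgue measure); all densities are with respect to these. A causal graphical model consists of a directed acyclic graph $G^*$ on $V$, conditional densities $p^*_j(x_j\mid x_{\mathrm{pa}_j^{G^*}};0)$, intervention targets $I_0=\varnothing$, $I_1,\dots,I_K\subseteq V$, and interventional densities $p^*_j(x_j;k)$ for $j\in I_k$. Its joint density in regime $k$ is $$p^*(x;k)=\prod_{j\notin I_k}p^*_j(x_j\mid x_{\mathrm{pa}_j^{G^*}};0)\prod_{j\in I_k}p^*_j(x_j;k),$$ and $p^*_j(x_j\mid x_{-j};k)=p^*(x;k)/\int p^*(x;k)\,dx_j$. Let $\pi_0,\dots,\pi_K\ge 0$, $\sum_k\pi_k=1$, be the proportions of the data that come from the regimes. A model class $\{p_\theta\}_{\theta\in\Theta}$ consists of conditional densities $p_j(x_j\mid x_{-j};\theta,k)$, which do not depend on $x_{-j}$ when $j\in I_k$. The graph $A_\theta$ has the edge $\ell\to j$ ($\ell\ne j$) iff $p_j(x_j\mid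 x_{-j};\theta,0)$ is not invariant to $x_\ell$; $|A_\theta|$ is its number of edges. Stage 1, solved exactly with infinite data and without relaxation, is $$\tilde\theta_1\in\operatorname*{argmax}_{\theta:\ A_\theta\text{ has no self-loops}}\ \sum_{j\in V} L_j(\theta)-\lambda|A_\theta|,\qquad L_j(\theta)=\sum_{k:\,j\notin I_k}\pi_k\,\mathbb E_{p^*(x;k)}\big[\log p_j(x_j\mid x_{-j};\theta,k)\big]\in[-\infty,\infty),$$ and $\tilde G_1=A_{\tilde\theta_1}$. Write $\mathrm{bo}_j=\big(\mathrm{pa}_j^{G^*}\cup\mathrm{ch}_j^{G^*}\cup\mathrm{pa}^{G^*}_{\mathrm{ch}_j^{G^*}}\big)\setminus\{j\}$. *Assumptions.* 1. $\pi_0>0$. 2. $p^*(x;k)>0$ and $p_j(x_j\mid x_{-j};\theta,k)>0$ for all $x,k,j,\theta$. 3. $p^*(\cdot\,;0)$ is faithful to $G^*$: for pairwise disjoint $A,B,C\subseteq V$, if $x_A$ and $x_B$ are conditionally independent given $x_C$ under $p^*(\cdot\,;0)$, then $C$ d-separates $A$ and $B$ in $G^*$. 4. The expected log-likelihoods $\mathbb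 E_{p^*(x;k)}[\log p_j^*(x_j\mid x_{-j};k)]$, $j\notin I_k$, are finite. 5. The model class can express the true model: there is one $\theta$ with $p_j(x_j\mid x_{-j};\theta,k)=p^*_j(x_j\mid x_{-j};k)$ for all $k$, all $j\notin I_k$ and all $x$. *Conclusion.* Under assumptions 1, 3, 4 and the positivity of $p^*$, for every $j$ the set $\mathrm{bo}_j$ is the unique Markov boundary of $j$ under $p^*(\cdot\,;0)$, that is, the unique minimal set $S\subseteq V\setminus\{j\}$ such that $x_j$ is conditionally independent of $x_{V\setminus(S\cup\{j\})}$ given $x_S$. Moreover there is $\lambda_0>0$, depending only on the causal graphical model and on $\pi$, such that for every model class that satisfies assumptions 2 and 5 and every $\lambda\in(0,\lambda_0)$: - stage 1 has a solution, and for every solution $\tilde\theta_1$ and every $j\in V$, $\mathrm{pa}_j^{\tilde G_1}=\mathrm{bo}_j$; in particular $\mathrm{pa}_j^{G^*}\subseteq\mathrm{pa}_j^{\tilde G_1}$, so stage 1 never removes a true causal parent; - the graph with parent sets $\mathrm{bo}_j$ is the unique maximizer, among the graphs $G$ without self-loops, of $\sup_{\theta:A_\theta=G}\big[\sum_jL_j(\theta)-\lambda|G|\big]$;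 - for every $j$, $\mathrm{bo}_j$ is the unique maximizer, among the sets $S\subseteq V\setminus\{j\}$, of $\sup_{\theta:\mathrm{pa}_j^{A_\theta}=S}\big[L_j(\theta)-\lambda|S|\big]$. -/

import Mathlib

open MeasureTheory ProbabilityTheory
open scoped ENNReal

namespace CausalStage

section Graphs

variable {V : Type*}

/-- A directed graph is acyclic if no vertex can be reached from itself by a nonempty
directed path. -/
def Acyclic (G : Digraph V) : Prop := ∀ v, ¬ Relation.TransGen G.Adj v v

/-- The parents of `j`; `G.Adj a b` is the edge `a → b`. -/
def parents (G : Digraph V) (j : V) : Set V := {i | G.Adj i j}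

/-- The children of `j`. -/
def children (G : Digraph V) (j : V) : Set V := {i | G.Adj j i}

/-- Parents, children and the other parents of the children of `j`. -/
def boundary (G : Digraph V) (j : V) : Set V :=
  (parents G j ∪ children G j ∪ ⋃ c ∈ children G j, parents G c) \ {j}

/-- The graph in which the parents of every `j` are `boundary G j`. -/
def boundaryGraph (G : Digraph V) : Digraph V where
  Adj i j := i ∈ boundary G j

/-- The number of edges of a directed graph. -/
noncomputable def edgeCount (G : Digraph V) : ℕ := Set.ncard {e : V × V | G.Adj e.1 e.2}

/-- A directed graph without self-loops. -/
def Loopless (G : Digraph V) : Prop := ∀ j, ¬ G.Adj j j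

/-- The undirected graph underlying `G`. -/
def skeleton (G : Digraph V) : SimpleGraph V where
  Adj a b := a ≠ b ∧ (G.Adj a b ∨ G.Adj b a)
  symm := ⟨fun _ _ h => ⟨h.1.symm, h.2.symm⟩⟩
  loopless := ⟨fun _ h => h.1 rfl⟩

/-- A path of the skeleton is active given `Z` if at each of its inner vertices `v`, with
neighbours `u` and `w` on the path: when `u → v ← w` is a collider, `v` or a descendant of `v`
lies in `Z`, and otherwise `v` is not in `Z`. -/
def ActiveGiven (G : Digraph V) (Z : Set V) {a b : V} (p : (skeleton G).Walk a b) : Prop :=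
  ∀ n, n + 2 ≤ p.length →
    ((G.Adj (p.getVert n) (p.getVert (n + 1)) ∧ G.Adj (p.getVert (n + 2)) (p.getVert (n + 1))) →
      ∃ z ∈ Z, Relation.ReflTransGen G.Adj (p.getVert (n + 1)) z) ∧
    (¬ (G.Adj (p.getVert n) (p.getVert (n + 1)) ∧
        G.Adj (p.getVert (n + 2)) (p.getVert (n + 1))) →
      p.getVert (n + 1) ∉ Z)

/-- `Z` d-separates `A` from `B`: no undirected path from `A` to `B` is active given `Z`. -/
def DSep (G : Digraph V) (A B Z : Set V) : Prop :=
  ∀ a ∈ A, ∀ b ∈ B, ∀ p : (skeleton G).Walk a b, p.IsPath → ¬ ActiveGiven G Z p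

end Graphs

section CausalModels

variable {V : Type*} [Fintype V] [DecidableEq V] {X : V → Type*} [∀ i, MeasurableSpace (X i)]

/-- A causal graphical model with variables `x i : X i`, whose densities are taken with respect
to the reference measures `μ i`, and with the regimes `0, …, K` (regime `0` is observational,
the others are perfect interventions). -/
structure CausalModel (X : V → Type*) [∀ i, MeasurableSpace (X i)] (μ : ∀ i, Measure (X i))
    (K : ℕ) where
  /-- the true graph -/
  graph : Digraph V
  acyclic : Acyclic graph
  /-- `cond j x` is the conditional density of `x j` given the parents of `j` -/
  cond : V → (∀ i, X i) → ℝ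
  cond_nonneg : ∀ j x, 0 ≤ cond j x
  cond_measurable : ∀ j, Measurable (cond j)
  cond_dependsOn : ∀ j, DependsOn (cond j) (insert j (parents graph j))
  cond_integral : ∀ j x, ∫ t, cond j (Function.update x j t) ∂(μ j) = 1
  /-- the targets of the interventions -/
  target : Fin (K + 1) → Finset V
  target_zero : target 0 = ∅
  /-- the density of `x j` when regime `k` intervenes on `j` -/
  interv : Fin (K + 1) → ∀ j, X j → ℝ
  interv_nonneg : ∀ k, ∀ j ∈ target k, ∀ t, 0 ≤ interv k j t
  interv_measurable : ∀ k, ∀ j ∈ target k, Measurable (interv k j)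
  interv_integral : ∀ k, ∀ j ∈ target k, ∫ t, interv k j t ∂(μ j) = 1

namespace CausalModel

variable {μ : ∀ i, Measure (X i)} {K : ℕ}

/-- The factor of variable `j` in the joint density of regime `k`. -/
def factor (M : CausalModel X μ K) (k : Fin (K + 1)) (j : V) (x : ∀ i, X i) : ℝ :=
  if j ∈ M.target k then M.interv k j (x j) else M.cond j x

/-- The joint density of regime `k`. -/
def joint (M : CausalModel X μ K) (k : Fin (K + 1)) (x : ∀ i, X i) : ℝ := ∏ j, M.factor k j x

/-- The joint distribution of the variables in regime `k`. -/
noncomputable def law (M : CausalModel X μ K) (k : Fin (K + 1)) : Measure (∀ i, X i) :=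
  (Measure.pi μ).withDensity fun x => ENNReal.ofReal (M.joint k x)

/-- The conditional density of `x j` given all the other variables in regime `k`. -/
noncomputable def fullCond (M : CausalModel X μ K) (k : Fin (K + 1)) (j : V) (x : ∀ i, X i) : ℝ :=
  M.joint k x / ∫ t, M.joint k (Function.update x j t) ∂(μ j)

theorem factor_nonneg (M : CausalModel X μ K) (k : Fin (K + 1)) (j : V) (x : ∀ i, X i) :
    0 ≤ M.factor k j x := by
  unfold factor
  split_ifs with h
  · exact M.interv_nonneg k j h _
  · exact M.cond_nonneg j x

theorem factor_measurable (M : CausalModel X μ K) (k : Fin (K + 1)) (j : V) :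
    Measurable (M.factor k j) := by
  by_cases h : j ∈ M.target k
  · have e : M.factor k j = fun x => M.interv k j (x j) := by
      funext x; simp [factor, h]
    rw [e]
    exact (M.interv_measurable k j h).comp (measurable_pi_apply j)
  · have e : M.factor k j = M.cond j := by
      funext x; simp [factor, h]
    rw [e]
    exact M.cond_measurable j

theorem factor_lintegral (M : CausalModel X μ K) (k : Fin (K + 1)) (j : V) (x : ∀ i, X i) :
    ∫⁻ t, ENNReal.ofReal (M.factor k j (Function.update x j t)) ∂(μ j) = 1 := by
  have h1 : ∫ t, M.factor k j (Function.update x j t) ∂(μ j) = 1 := by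
    by_cases h : j ∈ M.target k
    · simpa [factor, h] using M.interv_integral k j h
    · simpa [factor, h] using M.cond_integral j x
  have hi : Integrable (fun t => M.factor k j (Function.update x j t)) (μ j) := by
    by_contra hn
    rw [integral_undef hn] at h1
    exact zero_ne_one h1
  rw [← ofReal_integral_eq_lintegral_ofReal hi (ae_of_all _ fun t => M.factor_nonneg k j _), h1,
    ENNReal.ofReal_one]

theorem factor_update (M : CausalModel X μ K) (k : Fin (K + 1)) {i j : V} (hij : i ≠ j)
    (hadj : ¬ M.graph.Adj j i) (x : ∀ i, X i) (t : X j) :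
    M.factor k i (Function.update x j t) = M.factor k i x := by
  unfold factor
  split_ifs with h
  · rw [Function.update_of_ne hij]
  · refine M.cond_dependsOn i fun l hl => ?_
    refine Function.update_of_ne ?_ _ _
    rintro rfl
    rcases hl with rfl | hl
    · exact hij rfl
    · exact hadj hl

theorem exists_sink (M : CausalModel X μ K) (s : Finset V) (hs : s.Nonempty) :
    ∃ j ∈ s, ∀ i ∈ s, ¬ M.graph.Adj j i := by
  have : Std.Irrefl (Function.swap (Relation.TransGen M.graph.Adj)) := ⟨fun v => M.acyclic v⟩
  have : IsTrans V (Function.swap (Relation.TransGen M.graph.Adj)) :=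
    ⟨fun _ _ _ h1 h2 => Relation.TransGen.trans h2 h1⟩
  obtain ⟨j, hj, hmin⟩ :=
    (Finite.wellFounded_of_trans_of_irrefl
      (Function.swap (Relation.TransGen M.graph.Adj))).has_min (s : Set V) hs
  exact ⟨j, hj, fun i hi h => hmin i hi (Relation.TransGen.single h)⟩

theorem lmarginal_factors [∀ i, SigmaFinite (μ i)] (M : CausalModel X μ K) (k : Fin (K + 1)) :
    ∀ (n : ℕ) (s : Finset V), s.card = n → ∀ x,
      lmarginal μ s (fun x => ∏ i ∈ s, ENNReal.ofReal (M.factor k i x)) x = 1 := by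
  have hm : ∀ s : Finset V, Measurable fun x => ∏ i ∈ s, ENNReal.ofReal (M.factor k i x) :=
    fun s => Finset.measurable_prod _ fun i _ => (M.factor_measurable k i).ennreal_ofReal
  intro n
  induction n with
  | zero =>
    intro s hs x
    rw [Finset.card_eq_zero] at hs
    subst hs
    simp
  | succ n ih =>
    intro s hs x
    obtain ⟨j, hj, hsink⟩ := M.exists_sink s (Finset.card_pos.mp (by omega))
    rw [lmarginal_erase' _ (hm s) hj]
    have hin : (fun x => ∫⁻ t, ∏ i ∈ s,
        ENNReal.ofReal (M.factor k i (Function.update x j t)) ∂(μ j)) =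
        fun x => ∏ i ∈ s.erase j, ENNReal.ofReal (M.factor k i x) := by
      funext x
      have h2 : ∀ t, ∏ i ∈ s, ENNReal.ofReal (M.factor k i (Function.update x j t)) =
          ENNReal.ofReal (M.factor k j (Function.update x j t)) *
            ∏ i ∈ s.erase j, ENNReal.ofReal (M.factor k i x) := by
        intro t
        rw [← Finset.mul_prod_erase s _ hj]
        congr 1
        refine Finset.prod_congr rfl fun i hi => ?_
        rw [M.factor_update k (Finset.ne_of_mem_erase hi) (hsink i (Finset.mem_of_mem_erase hi))]
      simp_rw [h2]
      have h3 : Measurable fun t => ENNReal.ofReal (M.factor k j (Function.update x j t)) :=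
        ((M.factor_measurable k j).comp (measurable_update x)).ennreal_ofReal
      rw [lintegral_mul_const _ h3, M.factor_lintegral, one_mul]
    rw [hin]
    exact ih _ (by rw [Finset.card_erase_of_mem hj]; omega) x

/-- The joint density of each regime integrates to one. -/
instance law_isProbabilityMeasure [∀ i, SigmaFinite (μ i)] [∀ i, Nonempty (X i)]
    (M : CausalModel X μ K) (k : Fin (K + 1)) : IsProbabilityMeasure (M.law k) := by
  constructor
  have x : ∀ i, X i := fun i => Classical.arbitrary (X i)
  rw [law, withDensity_apply _ MeasurableSet.univ, Measure.restrict_univ,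
    lintegral_eq_lmarginal_univ x, ← M.lmarginal_factors k _ Finset.univ rfl x]
  congr 1
  funext y
  exact ENNReal.ofReal_prod_of_nonneg fun i _ => M.factor_nonneg k i y

end CausalModel

/-- The σ-algebra generated by the coordinates in `S`. -/
@[reducible] def coordSigma (X : V → Type*) [∀ i, MeasurableSpace (X i)] (S : Set V) :
    MeasurableSpace (∀ i, X i) :=
  MeasurableSpace.comap (fun x (i : S) => x i) inferInstance

theorem coordSigma_le (X : V → Type*) [∀ i, MeasurableSpace (X i)] (S : Set V) :
    coordSigma X S ≤ MeasurableSpace.pi :=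
  (measurable_pi_lambda _ fun i : S => measurable_pi_apply (i : V)).comap_le

/-- Under `P`, the variables in `A` are conditionally independent of those in `B` given those
in `C`. -/
def CondIndepVars [∀ i, StandardBorelSpace (X i)] (P : Measure (∀ i, X i)) [IsFiniteMeasure P]
    (A B C : Set V) : Prop :=
  CondIndep (coordSigma X C) (coordSigma X A) (coordSigma X B) (coordSigma_le X C) P

/-- `P` is faithful to `G`: every conditional independence that holds under `P` is a
d-separation of `G`. -/
def Faithful [∀ i, StandardBorelSpace (X i)] (P : Measure (∀ i, X i)) [IsFiniteMeasure P]
    (G : Digraph V) : Prop :=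
  ∀ A B C : Set V, Disjoint A B → Disjoint A C → Disjoint B C →
    CondIndepVars P A B C → DSep G A B C

/-- `S` renders `j` independent of all the other variables. -/
def IsMarkovBlanket [∀ i, StandardBorelSpace (X i)] (P : Measure (∀ i, X i)) [IsFiniteMeasure P]
    (j : V) (S : Set V) : Prop :=
  j ∉ S ∧ CondIndepVars P {j} (insert j S)ᶜ S

/-- A Markov boundary of `j` is a minimal set that renders `j` independent of all the others. -/
def IsMarkovBoundary [∀ i, StandardBorelSpace (X i)] (P : Measure (∀ i, X i)) [IsFiniteMeasure P]
    (j : V) (S : Set V) : Prop :=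
  Minimal (IsMarkovBlanket P j) S

/-- The expectation of `f` as an extended real number: the integral of the positive part minus
the integral of the negative part. -/
noncomputable def expect {Ω : Type*} [MeasurableSpace Ω] (P : Measure Ω) (f : Ω → ℝ) : EReal :=
  ((∫⁻ x, ENNReal.ofReal (f x) ∂P : ℝ≥0∞) : EReal) -
    ((∫⁻ x, ENNReal.ofReal (-f x) ∂P : ℝ≥0∞) : EReal)

/-- A model class with parameter set `Θ` and no a priori graph: every variable has, for each
parameter and regime, a conditional density given all the other variables. In a regime that
intervenes on `j`, the density of `x j` does not depend on the other variables. -/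
structure ModelClass (X : V → Type*) [∀ i, MeasurableSpace (X i)] (μ : ∀ i, Measure (X i))
    (K : ℕ) (target : Fin (K + 1) → Finset V) (Θ : Type*) where
  /-- `dens θ k j x` is the conditional density of `x j` given the other coordinates of `x` -/
  dens : Θ → Fin (K + 1) → V → (∀ i, X i) → ℝ
  dens_nonneg : ∀ θ k j x, 0 ≤ dens θ k j x
  dens_measurable : ∀ θ k j, Measurable (dens θ k j)
  dens_integral : ∀ θ k j x, ∫ t, dens θ k j (Function.update x j t) ∂(μ j) = 1
  dens_target : ∀ θ k, ∀ j ∈ target k, DependsOn (dens θ k j) {j}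

namespace ModelClass

variable {μ : ∀ i, Measure (X i)} {K : ℕ} {target : Fin (K + 1) → Finset V} {Θ : Type*}

/-- The graph that `θ` induces: there is no edge `l → j` exactly when the observational
conditional density of `x j` given the other variables is invariant to `x l`. -/
def graph (N : ModelClass X μ K target Θ) (θ : Θ) : Digraph V where
  Adj l j := l ≠ j ∧ ¬ ∀ x t, N.dens θ 0 j (Function.update x l t) = N.dens θ 0 j x

/-- The expected log-likelihood of variable `j` over the regimes that do not intervene on it;
`w k` is the proportion of the data that comes from regime `k` and `P k` is the distribution
of these data. -/
noncomputable def nodeLik (N : ModelClass X μ K target Θ) (P : Fin (K + 1) → Measure (∀ i, X i))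
    (w : Fin (K + 1) → ℝ) (j : V) (θ : Θ) : EReal :=
  ∑ k with j ∉ target k, (w k : EReal) * expect (P k) fun x => Real.log (N.dens θ k j x)

/-- The objective of stage 1 with infinite data and the number of edges as the penalty. -/
noncomputable def score (N : ModelClass X μ K target Θ) (P : Fin (K + 1) → Measure (∀ i, X i))
    (w : Fin (K + 1) → ℝ) (lam : ℝ) (θ : Θ) : EReal :=
  (∑ j, N.nodeLik P w j θ) - ((lam * (edgeCount (N.graph θ) : ℝ) : ℝ) : EReal)

/-- `θ` solves stage 1: it maximizes the objective among the parameters whose graph has no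
self-loops. -/
def IsSolution (N : ModelClass X μ K target Θ) (P : Fin (K + 1) → Measure (∀ i, X i))
    (w : Fin (K + 1) → ℝ) (lam : ℝ) (θ : Θ) : Prop :=
  Loopless (N.graph θ) ∧ ∀ θ', Loopless (N.graph θ') → N.score P w lam θ' ≤ N.score P w lam θ

/-- The supremum of the objective over the parameters that induce the graph `G`. -/
noncomputable def graphScore (N : ModelClass X μ K target Θ)
    (P : Fin (K + 1) → Measure (∀ i, X i)) (w : Fin (K + 1) → ℝ) (lam : ℝ) (G : Digraph V) :
    EReal :=
  ⨆ θ, ⨆ _ : N.graph θ = G, N.score P w lam θ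

/-- `G` maximizes the graph score among the graphs without self-loops. -/
def IsSolutionGraph (N : ModelClass X μ K target Θ) (P : Fin (K + 1) → Measure (∀ i, X i))
    (w : Fin (K + 1) → ℝ) (lam : ℝ) (G : Digraph V) : Prop :=
  Loopless G ∧ ∀ G', Loopless G' → N.graphScore P w lam G' ≤ N.graphScore P w lam G

/-- The supremum of the part of the objective that concerns variable `j`, over the parameters
for which `S` is the parent set of `j`. -/
noncomputable def parentScore (N : ModelClass X μ K target Θ)
    (P : Fin (K + 1) → Measure (∀ i, X i)) (w : Fin (K + 1) → ℝ) (lam : ℝ) (j : V) (S : Set V) :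
    EReal :=
  ⨆ θ, ⨆ _ : parents (N.graph θ) j = S,
    (N.nodeLik P w j θ - ((lam * (S.ncard : ℝ) : ℝ) : EReal))

/-- `S` solves the problem of variable `j`: it maximizes the parent score among the sets that
do not contain `j`. -/
def IsSolutionParents (N : ModelClass X μ K target Θ) (P : Fin (K + 1) → Measure (∀ i, X i))
    (w : Fin (K + 1) → ℝ) (lam : ℝ) (j : V) (S : Set V) : Prop :=
  j ∉ S ∧ ∀ S' : Set V, j ∉ S' → N.parentScore P w lam j S' ≤ N.parentScore P w lam j S

end ModelClass

/-- The model class can express the true model: for some parameter, in every regime, each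
variable that is not intervened on has the true conditional density given all the others. -/
def Expresses {μ : ∀ i, Measure (X i)} {K : ℕ} {Θ : Type*} (M : CausalModel X μ K)
    (N : ModelClass X μ K M.target Θ) : Prop :=
  ∃ θ, ∀ k j, j ∉ M.target k → ∀ x, N.dens θ k j x = M.fullCond k j x

end CausalModels

end CausalStage

namespace CausalStage

/-! ### Functions and events that involve only some of the coordinates -/

section Coordinates

variable {V : Type*} {X : V → Type*}

/-! In the observational full conditional of `x j`, all factors except those of `j` and its children
cancel, so it involves only `j` and `boundary M.graph j` (`fullCond_dependsOn`). Hence the boundary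
is a Markov blanket. By faithfulness every blanket contains it (`boundary_subset_of_condIndepVars`),
because an edge at `j`, or a collider at a common child, would otherwise give an active path. So the
boundary is the least blanket.

For the scores, no conditional density beats the true one, and one whose parents miss part of the
boundary loses at least a fixed `δ > 0` in regime 0, whatever the model class. Indeed the loss is at
least the expectation of `(1 - √(q/p)) ^ 2` (`expect_log_le`). If these expectations came
arbitrarily close to zero for densities `q` with parents in a fixed `S`, a sequence of them would
converge almost everywhere to the full conditional `p`, which would make `S` a blanket
(`exists_hellinger_gap`). There are finitely many pairs `(j, S)`, so one `δ` serves all; no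
compactness of the parameter set is needed.

A missing boundary element thus costs at least `w 0 * δ`, more than sparsity can save when `lam` is
small, while superfluous parents cost `lam` each and gain nothing. Likelihood and penalty are sums
over the variables, so these local gaps settle all three optimization problems (`solutions_of_gap`).
-/

theorem dependsOn_of_forall_update [Fintype V] [DecidableEq V] {β : Type*} {f : (∀ i, X i) → β}
    {s : Set V} (h : ∀ i ∉ s, ∀ x t, f (Function.update x i t) = f x) : DependsOn f s := by
  intro x y hxy
  -- Pass from `x` to `y` one coordinate at a time: inside `s` they agree already, outside `s` the
  -- hypothesis applies.
  have key : ∀ T : Finset V, f (fun i => if i ∈ T then y i else x i) = f x := by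
    intro T
    induction T using Finset.induction_on with
    | empty => simp
    | insert a T ha ih =>
      have e : (fun i => if i ∈ insert a T then y i else x i) =
          Function.update (fun i => if i ∈ T then y i else x i) a (y a) := by
        funext i
        by_cases hi : i = a
        · subst hi; simp
        · simp [hi]
      rw [e]
      by_cases has : a ∈ s
      · rw [← ih]
        congr 1
        rw [Function.update_eq_self_iff]
        simp [ha, hxy a has]
      · rw [h a has, ih]
  simpa using (key Finset.univ).symm

variable [∀ i, MeasurableSpace (X i)]

/-- Filling the coordinates outside `S` with an arbitrary point factors `f` through the restriction
to `S`. -/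
theorem measurable_coordSigma_of_dependsOn [∀ i, Nonempty (X i)] {β : Type*} [MeasurableSpace β]
    {f : (∀ i, X i) → β} {S : Set V} (hf : DependsOn f S) (hm : Measurable f) :
    Measurable[coordSigma X S] f := by
  classical
  let x₀ : ∀ i, X i := fun i => Classical.arbitrary (X i)
  let e : (∀ i : S, X i) → ∀ i, X i := fun y i => if h : i ∈ S then y ⟨i, h⟩ else x₀ i
  have he : Measurable e := by
    refine measurable_pi_lambda _ fun i => ?_
    by_cases h : i ∈ S
    · simpa [e, h] using measurable_pi_apply _
    · simp [e, h]
  have hfe : f = (f ∘ e) ∘ fun x (i : S) => x i := by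
    funext x
    exact hf fun i hi => by simp [e, hi]
  rw [hfe]
  exact (hm.comp he).comp (comap_measurable _)

theorem mem_iff_of_measurableSet_coordSigma {S : Set V} {B : Set (∀ i, X i)}
    (hB : MeasurableSet[coordSigma X S] B) {x y : ∀ i, X i} (h : ∀ i ∈ S, x i = y i) :
    x ∈ B ↔ y ∈ B := by
  obtain ⟨C, -, rfl⟩ := hB
  have : (fun i : S => x i) = fun i : S => y i := funext fun i => h i i.2
  simp only [Set.mem_preimage, this]

end Coordinates

/-! ### Integrating out one coordinate -/

section Resampling

variable {V : Type*} [Fintype V] [DecidableEq V] {X : V → Type*} [∀ i, MeasurableSpace (X i)]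
  {μ : ∀ i, Measure (X i)} [∀ i, SigmaFinite (μ i)]

omit [Fintype V] in
theorem measurable_lintegral_update {f : (∀ i, X i) → ℝ≥0∞} (hf : Measurable f) (j : V) :
    Measurable fun x => ∫⁻ t, f (Function.update x j t) ∂(μ j) :=
  (hf.comp measurable_update').lintegral_prod_right'

/-- Tonelli, with coordinate `j` innermost. The function `Z`, later the joint density, only serves
to discard the null set of fibres on which its integral is infinite. -/
theorem lintegral_pi_eq_of_update [∀ i, Nonempty (X i)] {f g Z : (∀ i, X i) → ℝ≥0∞}
    (hf : Measurable f) (hg : Measurable g) (hZ : Measurable Z) (j : V)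
    (hZ' : ∫⁻ x, Z x ∂(Measure.pi μ) ≠ ∞)
    (h : ∀ x, ∫⁻ t, Z (Function.update x j t) ∂(μ j) ≠ ∞ →
      ∫⁻ t, f (Function.update x j t) ∂(μ j) = ∫⁻ t, g (Function.update x j t) ∂(μ j)) :
    ∫⁻ x, f x ∂(Measure.pi μ) = ∫⁻ x, g x ∂(Measure.pi μ) := by
  let x₀ : ∀ i, X i := fun i => Classical.arbitrary (X i)
  rw [lintegral_eq_lmarginal_univ x₀, lmarginal_erase' _ hZ (Finset.mem_univ j), lmarginal] at hZ'
  rw [lintegral_eq_lmarginal_univ x₀, lintegral_eq_lmarginal_univ x₀,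
    lmarginal_erase' _ hf (Finset.mem_univ j), lmarginal_erase' _ hg (Finset.mem_univ j),
    lmarginal, lmarginal]
  have hm := (measurable_lintegral_update (μ := μ) hZ j).comp
    (measurable_updateFinset (s := Finset.univ.erase j) (x := x₀))
  refine lintegral_congr_ae ?_
  filter_upwards [ae_lt_top hm hZ'] with y hy
  exact h _ hy.ne

end Resampling

/-! ### Full conditional densities and invariance under resampling -/

section Gibbs

variable {V : Type*} [Fintype V] [DecidableEq V] {X : V → Type*} [∀ i, MeasurableSpace (X i)]
  {μ : ∀ i, Measure (X i)} {K : ℕ}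

namespace CausalModel

/-- The integral of the joint density of regime `k` over the variable `j`. -/
noncomputable def normalizer (M : CausalModel X μ K) (k : Fin (K + 1)) (j : V) (x : ∀ i, X i) :
    ℝ≥0∞ :=
  ∫⁻ t, ENNReal.ofReal (M.joint k (Function.update x j t)) ∂(μ j)

theorem joint_measurable (M : CausalModel X μ K) (k : Fin (K + 1)) : Measurable (M.joint k) :=
  Finset.measurable_prod _ fun j _ => M.factor_measurable k j

theorem joint_nonneg (M : CausalModel X μ K) (k : Fin (K + 1)) (x : ∀ i, X i) :
    0 ≤ M.joint k x :=
  Finset.prod_nonneg fun j _ => M.factor_nonneg k j x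

theorem normalizer_update (M : CausalModel X μ K) (k : Fin (K + 1)) (j : V) (x : ∀ i, X i)
    (t : X j) : M.normalizer k j (Function.update x j t) = M.normalizer k j x := by
  simp [normalizer]

theorem lintegral_law (M : CausalModel X μ K) (k : Fin (K + 1)) {F : (∀ i, X i) → ℝ≥0∞}
    (hF : Measurable F) :
    ∫⁻ x, F x ∂(M.law k) = ∫⁻ x, ENNReal.ofReal (M.joint k x) * F x ∂(Measure.pi μ) :=
  lintegral_withDensity_eq_lintegral_mul _ (M.joint_measurable k).ennreal_ofReal hF

/-- Where the normalizer is infinite, both sides are a division by zero, so `fullCond` vanishes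
there; this is why positivity of `fullCond` holds only almost everywhere. -/
theorem fullCond_eq_div_normalizer (M : CausalModel X μ K) (k : Fin (K + 1)) (j : V)
    (x : ∀ i, X i) : M.fullCond k j x = M.joint k x / (M.normalizer k j x).toReal := by
  rw [fullCond, normalizer, integral_eq_lintegral_of_nonneg_ae
    (ae_of_all _ fun t => M.joint_nonneg k _)
    ((M.joint_measurable k).comp (measurable_update x)).aestronglyMeasurable]

theorem fullCond_nonneg (M : CausalModel X μ K) (k : Fin (K + 1)) (j : V)
    (x : ∀ i, X i) : 0 ≤ M.fullCond k j x := by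
  rw [fullCond_eq_div_normalizer]
  exact div_nonneg (M.joint_nonneg k x) ENNReal.toReal_nonneg

/-- A positive function has integral zero only for `μ j = 0`, but the factor of `j` integrates to
one. -/
theorem normalizer_ne_zero (M : CausalModel X μ K) {k : Fin (K + 1)} (hpos : ∀ x, 0 < M.joint k x)
    (j : V) (x : ∀ i, X i) : M.normalizer k j x ≠ 0 := by
  have hm : Measurable fun t => ENNReal.ofReal (M.joint k (Function.update x j t)) :=
    ((M.joint_measurable k).comp (measurable_update x)).ennreal_ofReal
  intro h
  rw [normalizer, lintegral_eq_zero_iff hm] at h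
  have hμ : μ j = 0 := by
    rw [← ae_eq_bot, ← Filter.eventually_false_iff_eq_bot]
    filter_upwards [h] with t ht
    exact absurd ht (by simpa using hpos _)
  simpa [hμ] using M.factor_lintegral k j x

theorem ofReal_fullCond (M : CausalModel X μ K) {k : Fin (K + 1)} (hpos : ∀ x, 0 < M.joint k x)
    {j : V} {x : ∀ i, X i} (hx : M.normalizer k j x ≠ ∞) :
    ENNReal.ofReal (M.fullCond k j x) = ENNReal.ofReal (M.joint k x) / M.normalizer k j x := by
  rw [fullCond_eq_div_normalizer,
    ENNReal.ofReal_div_of_pos (ENNReal.toReal_pos (M.normalizer_ne_zero hpos j x) hx),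
    ENNReal.ofReal_toReal hx]

theorem fullCond_pos (M : CausalModel X μ K) {k : Fin (K + 1)} (hpos : ∀ x, 0 < M.joint k x)
    {j : V} {x : ∀ i, X i} (hx : M.normalizer k j x ≠ ∞) : 0 < M.fullCond k j x := by
  rw [fullCond_eq_div_normalizer]
  exact div_pos (hpos x) (ENNReal.toReal_pos (M.normalizer_ne_zero hpos j x) hx)

variable [∀ i, SigmaFinite (μ i)]

theorem normalizer_measurable (M : CausalModel X μ K) (k : Fin (K + 1)) (j : V) :
    Measurable (M.normalizer k j) :=
  measurable_lintegral_update (M.joint_measurable k).ennreal_ofReal j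

theorem fullCond_measurable (M : CausalModel X μ K) (k : Fin (K + 1)) (j : V) :
    Measurable (M.fullCond k j) := by
  have h : M.fullCond k j = fun x => M.joint k x / (M.normalizer k j x).toReal :=
    funext fun x => M.fullCond_eq_div_normalizer k j x
  rw [h]
  exact (M.joint_measurable k).div (M.normalizer_measurable k j).ennreal_toReal

variable [∀ i, Nonempty (X i)]

theorem lintegral_joint (M : CausalModel X μ K) (k : Fin (K + 1)) :
    ∫⁻ x, ENNReal.ofReal (M.joint k x) ∂(Measure.pi μ) = 1 := by
  have h := M.lintegral_law k (F := fun _ => 1) measurable_const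
  simpa using h.symm

theorem ae_normalizer_ne_top (M : CausalModel X μ K) (k : Fin (K + 1)) (j : V) :
    ∀ᵐ x ∂(M.law k), M.normalizer k j x ≠ ∞ := by
  have hs : MeasurableSet {x | M.normalizer k j x = ∞} :=
    M.normalizer_measurable k j (measurableSet_singleton _)
  have hF : Measurable ({x | M.normalizer k j x = ∞}.indicator (1 : (∀ i, X i) → ℝ≥0∞)) :=
    measurable_one.indicator hs
  have hJ := (M.joint_measurable k).ennreal_ofReal
  rw [ae_iff]
  simp only [ne_eq, not_not]
  rw [← lintegral_indicator_one hs, M.lintegral_law k hF]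
  refine (lintegral_pi_eq_of_update (hJ.mul hF) (measurable_const (a := (0 : ℝ≥0∞))) hJ j
    (by simp [lintegral_joint]) ?_).trans (by simp)
  -- The exceptional set does not involve coordinate `j`, so a fibre with finite normalizer misses
  -- it entirely.
  · intro x hx
    have h : ∀ t, Function.update x j t ∉ {x | M.normalizer k j x = ∞} := fun t => by
      rw [Set.mem_ofPred_eq, normalizer_update]
      exact hx
    simp [h]

/-- The law of regime `k` is invariant under resampling the variable `j` from its full
conditional density. -/
theorem lintegral_resample (M : CausalModel X μ K) {k : Fin (K + 1)} (hpos : ∀ x, 0 < M.joint k x)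
    (j : V) {F : (∀ i, X i) → ℝ≥0∞} (hF : Measurable F) :
    ∫⁻ x, F x ∂(M.law k) = ∫⁻ x, ∫⁻ t, F (Function.update x j t) *
      ENNReal.ofReal (M.fullCond k j (Function.update x j t)) ∂(μ j) ∂(M.law k) := by
  have hJ := (M.joint_measurable k).ennreal_ofReal
  have hG : Measurable fun x => ∫⁻ t, F (Function.update x j t) *
      ENNReal.ofReal (M.fullCond k j (Function.update x j t)) ∂(μ j) :=
    measurable_lintegral_update (hF.mul (M.fullCond_measurable k j).ennreal_ofReal) j
  rw [M.lintegral_law k hF, M.lintegral_law k hG]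
  refine lintegral_pi_eq_of_update (hJ.mul hF) (hJ.mul hG) hJ j (by simp [lintegral_joint]) ?_
  intro x hx
  have hx' : M.normalizer k j x ≠ ∞ := hx
  have hJx : Measurable fun t => ENNReal.ofReal (M.joint k (Function.update x j t)) :=
    hJ.comp (measurable_update x)
  simp only [Function.update_idem]
  rw [lintegral_mul_const _ hJx]
  -- The resampled integral no longer involves `x j`, so integrating the joint density over `x j`
  -- leaves only the normalizer.
  change _ = M.normalizer k j x * _
  rw [← lintegral_const_mul' _ _ hx']
  refine lintegral_congr fun t => ?_
  rw [M.ofReal_fullCond hpos (by rwa [normalizer_update]), normalizer_update, mul_left_comm,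
    ENNReal.mul_div_cancel (M.normalizer_ne_zero hpos j x) hx', mul_comm]

/-- Resampling from a function that almost everywhere equals the full conditional density. -/
theorem lintegral_resample_of_ae_eq (M : CausalModel X μ K) {k : Fin (K + 1)}
    (hpos : ∀ x, 0 < M.joint k x) (j : V) {q : (∀ i, X i) → ℝ≥0∞} (hq : Measurable q)
    (hqp : ∀ᵐ x ∂(M.law k), ENNReal.ofReal (M.fullCond k j x) = q x)
    {F : (∀ i, X i) → ℝ≥0∞} (hF : Measurable F) :
    ∫⁻ x, F x ∂(M.law k) =
      ∫⁻ x, ∫⁻ t, F (Function.update x j t) * q (Function.update x j t) ∂(μ j) ∂(M.law k) := by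
  have hp := (M.fullCond_measurable k j).ennreal_ofReal
  -- The factor `q / p` is inserted before resampling, where the almost everywhere equality applies;
  -- afterwards `p` cancels on almost every fibre and leaves `q`.
  have h0 : ∫⁻ x, F x ∂(M.law k) =
      ∫⁻ x, F x * q x / ENNReal.ofReal (M.fullCond k j x) ∂(M.law k) := by
    refine lintegral_congr_ae ?_
    filter_upwards [hqp, M.ae_normalizer_ne_top k j] with x hx hx'
    rw [← hx, ENNReal.mul_div_cancel_right (by simpa using M.fullCond_pos hpos hx')
      ENNReal.ofReal_ne_top]
  have hm : Measurable fun x => F x * q x / ENNReal.ofReal (M.fullCond k j x) :=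
    (hF.mul hq).div hp
  rw [h0, M.lintegral_resample hpos j hm]
  refine lintegral_congr_ae ?_
  filter_upwards [M.ae_normalizer_ne_top k j] with x hx
  refine lintegral_congr fun t => ?_
  have hx' : M.normalizer k j (Function.update x j t) ≠ ∞ := by rwa [normalizer_update]
  exact ENNReal.div_mul_cancel (by simpa using M.fullCond_pos hpos hx') ENNReal.ofReal_ne_top

/-- The ratio of a conditional density and the true one has expectation at most one. -/
theorem lintegral_ratio_le_one (M : CausalModel X μ K) {k : Fin (K + 1)}
    (hpos : ∀ x, 0 < M.joint k x) (j : V) {q : (∀ i, X i) → ℝ} (hq : Measurable q)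
    (hq_int : ∀ x, ∫⁻ t, ENNReal.ofReal (q (Function.update x j t)) ∂(μ j) = 1) :
    ∫⁻ x, ENNReal.ofReal (q x / M.fullCond k j x) ∂(M.law k) ≤ 1 := by
  have hm : Measurable fun x => ENNReal.ofReal (q x / M.fullCond k j x) :=
    (hq.div (M.fullCond_measurable k j)).ennreal_ofReal
  rw [M.lintegral_resample hpos j hm]
  calc _ ≤ ∫⁻ _, 1 ∂(M.law k) := by
        refine lintegral_mono fun x => ?_
        rw [← hq_int x]
        refine lintegral_mono fun t => ?_
        simp only
        rw [← ENNReal.ofReal_mul' (M.fullCond_nonneg k j _)]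
        -- Where `fullCond` vanishes the ratio is zero by convention, hence an inequality only.
        rcases eq_or_ne (M.fullCond k j (Function.update x j t)) 0 with h | h
        · simp [h]
        · rw [div_mul_cancel₀ _ h]
    _ = 1 := by simp

end CausalModel

end Gibbs
-- Markov blankets, from densities and from faithfulness
section Blankets

variable {V : Type*} [Fintype V] [DecidableEq V] {X : V → Type*} [∀ i, MeasurableSpace (X i)]
  {μ : ∀ i, Measure (X i)} {K : ℕ} [∀ i, SigmaFinite (μ i)] [∀ i, Nonempty (X i)]
  [∀ i, StandardBorelSpace (X i)]

/-- If the full conditional density of `x j` almost everywhere equals a function of the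
coordinates in `insert j S`, then `S` renders `j` independent of all the other variables. -/
theorem CausalModel.condIndepVars_of_fullCond_ae_eq (M : CausalModel X μ K) {k : Fin (K + 1)}
    (hpos : ∀ x, 0 < M.joint k x) {j : V} {S : Set V} (hj : j ∉ S) {q : (∀ i, X i) → ℝ≥0∞}
    (hq : Measurable q) (hqS : DependsOn q (insert j S))
    (hqp : ∀ᵐ x ∂(M.law k), ENNReal.ofReal (M.fullCond k j x) = q x) :
    CondIndepVars (M.law k) {j} (insert j S)ᶜ S := by
  classical
  rw [CondIndepVars, condIndep_iff _ _ _ _ (coordSigma_le X _) (coordSigma_le X _)]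
  intro t₁ t₂ ht₁ ht₂
  have ht₁' : MeasurableSet t₁ := coordSigma_le X _ _ ht₁
  have ht₂' : MeasurableSet t₂ := coordSigma_le X _ _ ht₂
  have hle := coordSigma_le X S
  set P := M.law k with hP
  -- The candidate for the conditional probability of `t₁` given `S`: since `t₁` involves only
  -- coordinate `j`, integrating `x j` against `q` leaves a function of the coordinates in `S`.
  let h : (∀ i, X i) → ℝ≥0∞ := fun x =>
    ∫⁻ t, t₁.indicator 1 (Function.update x j t) * q (Function.update x j t) ∂(μ j)
  have hone : Measurable (1 : (∀ i, X i) → ℝ≥0∞) := measurable_one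
  have hm : Measurable h := measurable_lintegral_update ((hone.indicator ht₁').mul hq) j
  have hS : DependsOn h S := by
    intro x y hxy
    refine lintegral_congr fun t => ?_
    have e : ∀ i ∈ insert j S, Function.update x j t i = Function.update y j t i := by
      intro i hi
      rcases eq_or_ne i j with rfl | hij
      · simp
      · simp [hij, hxy i (hi.resolve_left hij)]
    rw [hqS e]
    congr 1
    have := mem_iff_of_measurableSet_coordSigma ht₁
      (x := Function.update x j t) (y := Function.update y j t) (by simp)
    simp only [Set.indicator_apply, this, Pi.one_apply]
  have hmS : Measurable[coordSigma X S] h := measurable_coordSigma_of_dependsOn hS hm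
  -- Resampling `x j` leaves such `B` alone. Used with `B` in the σ-algebra of `S` this identifies
  -- `h`; used with `C ∩ t₂` it gives the product formula.
  have hres : ∀ B, MeasurableSet B → (∀ x t, Function.update x j t ∈ B ↔ x ∈ B) →
      ∫⁻ x in B, h x ∂P = P (t₁ ∩ B) := by
    intro B hB hBj
    rw [← lintegral_indicator_one (ht₁'.inter hB),
      M.lintegral_resample_of_ae_eq hpos j hq hqp (hone.indicator (ht₁'.inter hB)),
      ← lintegral_indicator hB]
    refine lintegral_congr fun x => ?_
    by_cases hx : x ∈ B
    · rw [Set.indicator_of_mem hx]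
      refine lintegral_congr fun t => ?_
      congr 1
      simp only [Set.indicator_apply, Set.mem_inter_iff, hBj, hx, and_true, Pi.one_apply]
    · simp [hBj, hx]
  have hfin : ∫⁻ x, h x ∂P ≠ ∞ := by
    have := hres Set.univ MeasurableSet.univ (by simp)
    rw [Measure.restrict_univ] at this
    rw [this]
    exact measure_ne_top _ _
  have hint : Integrable (fun x => (h x).toReal) P :=
    integrable_toReal_of_lintegral_ne_top hm.aemeasurable hfin
  have hset : ∀ B, MeasurableSet B → (∀ x t, Function.update x j t ∈ B ↔ x ∈ B) →
      ∫ x in B, (h x).toReal ∂P = P.real (t₁ ∩ B) := by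
    intro B hB hBj
    rw [integral_toReal hm.aemeasurable (ae_restrict_of_ae (ae_lt_top hm hfin)), hres B hB hBj]
    rfl
  have hinv : ∀ {A : Set V} {B}, j ∉ A → MeasurableSet[coordSigma X A] B →
      ∀ x t, Function.update x j t ∈ B ↔ x ∈ B := by
    intro A B hA hB x t
    refine mem_iff_of_measurableSet_coordSigma hB fun i hi => ?_
    exact Function.update_of_ne (by rintro rfl; exact hA hi) _ _
  have hind : ∀ {A : Set (∀ i, X i)}, MeasurableSet A →
      Integrable (A.indicator fun _ => (1 : ℝ)) P := fun hA => (integrable_const 1).indicator hA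
  have hA : (fun x => (h x).toReal) =ᵐ[P] P⟦t₁ | coordSigma X S⟧ := by
    refine ae_eq_condExp_of_forall_setIntegral_eq hle (hind ht₁') (fun _ _ _ => hint.integrableOn)
      ?_ hmS.ennreal_toReal.stronglyMeasurable.aestronglyMeasurable
    intro C hC _
    rw [hset C (hle _ hC) (hinv hj hC), integral_indicator ht₁', setIntegral_const,
      measureReal_restrict_apply ht₁']
    simp
  have hprod : (fun x => (h x).toReal) * (t₂.indicator fun _ => (1 : ℝ)) =
      t₂.indicator fun x => (h x).toReal := by
    funext x
    by_cases hx : x ∈ t₂ <;> simp [hx]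
  have hint₂ : Integrable ((fun x => (h x).toReal) * (t₂.indicator fun _ => (1 : ℝ))) P := by
    rw [hprod]
    exact hint.indicator ht₂'
  have hB : P[(fun x => (h x).toReal) * (t₂.indicator fun _ => (1 : ℝ)) | coordSigma X S] =ᵐ[P]
      P⟦t₁ ∩ t₂ | coordSigma X S⟧ := by
    refine ae_eq_condExp_of_forall_setIntegral_eq hle (hind (ht₁'.inter ht₂'))
      (fun _ _ _ => integrable_condExp.integrableOn) ?_
      stronglyMeasurable_condExp.aestronglyMeasurable
    intro C hC _
    rw [setIntegral_condExp hle hint₂ hC, hprod, setIntegral_indicator ht₂',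
      hset _ ((hle _ hC).inter ht₂'), setIntegral_indicator (ht₁'.inter ht₂'), setIntegral_const]
    · simp only [smul_eq_mul, mul_one]
      congr 1
      ext x
      simp only [Set.mem_inter_iff]
      tauto
    · intro x t
      rw [Set.mem_inter_iff, Set.mem_inter_iff, hinv hj hC, hinv (by simp) ht₂]
  have hC := condExp_mul_of_stronglyMeasurable_left (μ := P) (m := coordSigma X S)
    hmS.ennreal_toReal.stronglyMeasurable hint₂ (hind ht₂')
  filter_upwards [hA, hB, hC] with x hxA hxB hxC
  rw [← hxB, hxC, Pi.mul_apply, Pi.mul_apply, hxA]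

omit [∀ i, Nonempty (X i)] in
/-- A faithful law has no Markov blanket that misses an element of the boundary. -/
theorem boundary_subset_of_condIndepVars {G : Digraph V} (hG : Acyclic G)
    {P : Measure (∀ i, X i)} [IsFiniteMeasure P] (hP : Faithful P G) {j : V} {S : Set V}
    (hj : j ∉ S) (h : CondIndepVars P {j} (insert j S)ᶜ S) : boundary G j ⊆ S := by
  have hirr : ∀ v, ¬ G.Adj v v := fun v hv => hG v (Relation.TransGen.single hv)
  have hsep := hP _ _ _ (Set.disjoint_compl_right_iff_subset.mpr
    (Set.singleton_subset_iff.mpr (Set.mem_insert _ _))) (by simpa using hj)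
    (Set.disjoint_left.mpr fun x hx hxS => (Set.mem_compl_iff _ _).mp hx (Or.inr hxS)) h
  -- A single edge has no inner vertex, so it is active given any set.
  have hadj : ∀ c, (skeleton G).Adj j c → c ∈ S := by
    intro c hc
    by_contra hcS
    refine hsep j rfl c ?_ (SimpleGraph.Walk.cons hc .nil) (by simpa using hc.1) ?_
    · rintro (rfl | h)
      exacts [hc.1 rfl, hcS h]
    · intro n hn
      simp at hn
  intro l hl
  obtain ⟨(hl | hl) | hl, hlj : l ≠ j⟩ := hl
  · exact hadj l ⟨hlj.symm, Or.inr hl⟩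
  · exact hadj l ⟨hlj.symm, Or.inl hl⟩
  · simp only [Set.mem_iUnion] at hl
    obtain ⟨c, hc : G.Adj j c, hlc : G.Adj l c⟩ := hl
    have hjc : j ≠ c := fun e => hirr c (by rwa [e] at hc)
    have hlc' : l ≠ c := fun e => hirr c (by rwa [e] at hlc)
    -- The common child is a neighbour of `j`, hence already in `S`, which opens the collider `j → c
    -- ← l`.
    have hcS : c ∈ S := hadj c ⟨hjc, Or.inl hc⟩
    by_contra hlS
    have h1 : (skeleton G).Adj j c := ⟨hjc, Or.inl hc⟩
    have h2 : (skeleton G).Adj c l := ⟨hlc'.symm, Or.inr hlc⟩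
    refine hsep j rfl l ?_ (.cons h1 (.cons h2 .nil)) ?_ ?_
    · rintro (rfl | h)
      exacts [hlj rfl, hlS h]
    · simp [SimpleGraph.Walk.cons_isPath_iff, hjc, hlj.symm, hlc'.symm]
    · intro n hn
      obtain rfl : n = 0 := by simpa using hn
      simp only [SimpleGraph.Walk.getVert_zero, SimpleGraph.Walk.getVert_cons_succ, zero_add]
      exact ⟨fun _ => ⟨c, hcS, .refl⟩, fun hn => absurd ⟨hc, hlc⟩ hn⟩

end Blankets

/-! ### Likelihood loss and Hellinger distance -/

section Gaps

/-- Monotonicity of the positive and negative parts suffices, so `f` need not be integrable and its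
expectation may be `-∞`. -/
theorem expect_le_integral {Ω : Type*} [MeasurableSpace Ω] {P : Measure Ω} {f g : Ω → ℝ}
    (hg : Integrable g P) (h : f ≤ᵐ[P] g) : expect P f ≤ ((∫ x, g x ∂P : ℝ) : EReal) := by
  have hp : ∫⁻ x, ENNReal.ofReal (g x) ∂P ≠ ∞ := hg.lintegral_lt_top.ne
  have hn : ∫⁻ x, ENNReal.ofReal (-g x) ∂P ≠ ∞ := hg.neg.lintegral_lt_top.ne
  rw [integral_eq_lintegral_pos_part_sub_lintegral_neg_part hg, EReal.coe_sub,
    EReal.coe_ennreal_toReal hp, EReal.coe_ennreal_toReal hn]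
  refine EReal.sub_le_sub (EReal.coe_ennreal_le_coe_ennreal_iff.mpr (lintegral_mono_ae ?_))
    (EReal.coe_ennreal_le_coe_ennreal_iff.mpr (lintegral_mono_ae ?_))
  · filter_upwards [h] with x hx using ENNReal.ofReal_le_ofReal hx
  · filter_upwards [h] with x hx using ENNReal.ofReal_le_ofReal (neg_le_neg hx)

theorem expect_eq_integral {Ω : Type*} [MeasurableSpace Ω] {P : Measure Ω} {g : Ω → ℝ}
    (hg : Integrable g P) : expect P g = ((∫ x, g x ∂P : ℝ) : EReal) := by
  have hp : ∫⁻ x, ENNReal.ofReal (g x) ∂P ≠ ∞ := hg.lintegral_lt_top.ne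
  have hn : ∫⁻ x, ENNReal.ofReal (-g x) ∂P ≠ ∞ := hg.neg.lintegral_lt_top.ne
  rw [integral_eq_lintegral_pos_part_sub_lintegral_neg_part hg, EReal.coe_sub,
    EReal.coe_ennreal_toReal hp, EReal.coe_ennreal_toReal hn, expect]

/-- With `g = q / p`, `log g = 2 log √g ≤ 2 (√g - 1) = g - 1 - (1 - √g) ^ 2`. -/
theorem log_le_log_add_hellinger {p q : ℝ} (hp : 0 < p) (hq : 0 < q) :
    Real.log q ≤ Real.log p + (q / p - 1 - (1 - √(q / p)) ^ 2) := by
  have hg : 0 < q / p := div_pos hq hp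
  have h1 : Real.log q = Real.log p + 2 * Real.log √(q / p) := by
    rw [Real.log_sqrt hg.le, Real.log_div hq.ne' hp.ne']
    ring
  have h2 := Real.log_le_sub_one_of_pos (Real.sqrt_pos.mpr hg)
  have h3 := Real.sq_sqrt hg.le
  nlinarith

variable {V : Type*} [Fintype V] [DecidableEq V] {X : V → Type*} [∀ i, MeasurableSpace (X i)]
  {μ : ∀ i, Measure (X i)} {K : ℕ}

namespace CausalModel

/-- The joint density is `A * R`, with `A` the factors of `j` and its children. The rest `R` does
not involve `x j` and cancels in the quotient. -/
theorem fullCond_dependsOn (M : CausalModel X μ K) (hpos : ∀ x, 0 < M.joint 0 x) (j : V) :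
    DependsOn (M.fullCond 0 j) (insert j (boundary M.graph j)) := by
  classical
  have hirr : ∀ v, ¬ M.graph.Adj v v := fun v hv => M.acyclic v (Relation.TransGen.single hv)
  have hf : ∀ i, M.factor 0 i = M.cond i := fun i => by funext x; simp [factor, M.target_zero]
  let s : Finset V := {i | i = j ∨ M.graph.Adj j i}
  let A : (∀ i, X i) → ℝ := fun x => ∏ i ∈ s, M.factor 0 i x
  let R : (∀ i, X i) → ℝ := fun x => ∏ i ∈ sᶜ, M.factor 0 i x
  have hJ : ∀ x, M.joint 0 x = A x * R x := fun x => (Finset.prod_mul_prod_compl _ _).symm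
  have hR : ∀ x t, R (Function.update x j t) = R x := by
    intro x t
    refine Finset.prod_congr rfl fun i hi => ?_
    simp only [s, Finset.mem_compl, Finset.mem_filter, Finset.mem_univ, true_and, not_or] at hi
    exact M.factor_update 0 hi.1 hi.2 x t
  have hR0 : ∀ x, R x ≠ 0 := fun x h => by
    have := hpos x
    rw [hJ, h, mul_zero] at this
    exact lt_irrefl _ this
  have hA : DependsOn A (insert j (boundary M.graph j)) := by
    intro x y hxy
    refine Finset.prod_congr rfl fun i hi => ?_
    simp only [s, Finset.mem_filter, Finset.mem_univ, true_and] at hi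
    rw [hf]
    refine M.cond_dependsOn i fun l hl => hxy l ?_
    by_cases hlj : l = j
    · exact Or.inl hlj
    refine Or.inr ⟨?_, hlj⟩
    rcases hi with rfl | hi
    · exact Or.inl (Or.inl (hl.resolve_left hlj))
    · rcases hl with rfl | hl
      · exact Or.inl (Or.inr hi)
      · exact Or.inr (Set.mem_biUnion hi hl)
  have hc : ∀ x, M.fullCond 0 j x = A x / ∫ t, A (Function.update x j t) ∂(μ j) := by
    intro x
    simp only [fullCond, hJ, hR, integral_mul_const]
    exact mul_div_mul_right _ _ (hR0 x)
  intro x y hxy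
  rw [hc, hc, hA hxy]
  congr 1
  refine integral_congr_ae (ae_of_all _ fun t => hA fun i hi => ?_)
  rcases eq_or_ne i j with rfl | hij
  · simp
  · simp [hij, hxy i hi]

variable [∀ i, SigmaFinite (μ i)] [∀ i, Nonempty (X i)]

/-- A lower bound on the squared Hellinger distance bounds the loss in expected log-likelihood. -/
theorem expect_log_le (M : CausalModel X μ K) {k : Fin (K + 1)} (hpos : ∀ x, 0 < M.joint k x)
    {j : V} (hint : Integrable (fun x => Real.log (M.fullCond k j x)) (M.law k))
    {q : (∀ i, X i) → ℝ} (hq : Measurable q) (hq_pos : ∀ x, 0 < q x)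
    (hq_int : ∀ x, ∫⁻ t, ENNReal.ofReal (q (Function.update x j t)) ∂(μ j) = 1) {δ : ℝ}
    (hδ : ENNReal.ofReal δ ≤
      ∫⁻ x, ENNReal.ofReal ((1 - √(q x / M.fullCond k j x)) ^ 2) ∂(M.law k)) :
    expect (M.law k) (fun x => Real.log (q x)) ≤
      ((∫ x, Real.log (M.fullCond k j x) ∂(M.law k) - δ : ℝ) : EReal) := by
  have hg0 : ∀ x, 0 ≤ q x / M.fullCond k j x :=
    fun x => div_nonneg (hq_pos x).le (M.fullCond_nonneg k j x)
  have hgm : Measurable fun x => q x / M.fullCond k j x := hq.div (M.fullCond_measurable k j)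
  have hle := M.lintegral_ratio_le_one hpos j hq hq_int
  have hgi : Integrable (fun x => q x / M.fullCond k j x) (M.law k) :=
    (lintegral_ofReal_ne_top_iff_integrable hgm.aestronglyMeasurable (ae_of_all _ hg0)).mp
      (hle.trans_lt ENNReal.one_lt_top).ne
  have hg1 : ∫ x, q x / M.fullCond k j x ∂(M.law k) ≤ 1 := by
    rw [← ofReal_integral_eq_lintegral_ofReal hgi (ae_of_all _ hg0)] at hle
    simpa using hle
  have hhi : Integrable (fun x => (1 - √(q x / M.fullCond k j x)) ^ 2) (M.law k) := by
    refine ((integrable_const (1 : ℝ)).add hgi).mono'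
      ((measurable_const.sub hgm.sqrt).pow_const 2).aestronglyMeasurable (ae_of_all _ fun x => ?_)
    rw [Real.norm_of_nonneg (sq_nonneg _), Pi.add_apply]
    nlinarith [Real.sq_sqrt (hg0 x), Real.sqrt_nonneg (q x / M.fullCond k j x)]
  have hh : δ ≤ ∫ x, (1 - √(q x / M.fullCond k j x)) ^ 2 ∂(M.law k) := by
    rw [← ofReal_integral_eq_lintegral_ofReal hhi (ae_of_all _ fun x => sq_nonneg _)] at hδ
    exact (ENNReal.ofReal_le_ofReal_iff (integral_nonneg fun x => sq_nonneg _)).mp hδ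
  have h1 : Integrable (fun x => q x / M.fullCond k j x - 1) (M.law k) :=
    hgi.sub (integrable_const 1)
  have h2 : Integrable (fun x => q x / M.fullCond k j x - 1 -
      (1 - √(q x / M.fullCond k j x)) ^ 2) (M.law k) := h1.sub hhi
  refine (expect_le_integral (hint.add h2) ?_).trans ?_
  · filter_upwards [M.ae_normalizer_ne_top k j] with x hx
    exact log_le_log_add_hellinger (M.fullCond_pos hpos hx) (hq_pos x)
  · rw [EReal.coe_le_coe_iff]
    simp only [Pi.add_apply]
    rw [integral_add hint h2, integral_sub h1 hhi, integral_sub hgi (integrable_const 1)]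
    simp only [integral_const, probReal_univ, smul_eq_mul, mul_one]
    linarith

variable [∀ i, StandardBorelSpace (X i)]

/-- Densities that do not depend on some element of the boundary stay away from the true full
conditional density in Hellinger distance. -/
theorem exists_hellinger_gap (M : CausalModel X μ K) (hpos : ∀ x, 0 < M.joint 0 x)
    (hfaithful : Faithful (M.law 0) M.graph) {j : V} {S : Set V} (hj : j ∉ S)
    (hS : ¬ boundary M.graph j ⊆ S) :
    ∃ δ : ℝ, 0 < δ ∧ ∀ q : (∀ i, X i) → ℝ, Measurable q → (∀ x, 0 < q x) →
      DependsOn q (insert j S) → ENNReal.ofReal δ ≤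
        ∫⁻ x, ENNReal.ofReal ((1 - √(q x / M.fullCond 0 j x)) ^ 2) ∂(M.law 0) := by
  by_contra! hcon
  -- Summable bounds give almost everywhere convergence without passing to a subsequence.
  choose q hqm hqpos hqS hqlt using fun n : ℕ => hcon ((1 / 2) ^ n) (by positivity)
  have hgm : ∀ n, Measurable fun x =>
      ENNReal.ofReal ((1 - √(q n x / M.fullCond 0 j x)) ^ 2) := fun n =>
    ((measurable_const.sub ((hqm n).div (M.fullCond_measurable 0 j)).sqrt).pow_const
      2).ennreal_ofReal
  have hsum : ∫⁻ x, ∑' n, ENNReal.ofReal ((1 - √(q n x / M.fullCond 0 j x)) ^ 2) ∂(M.law 0) ≠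
      ∞ := by
    rw [lintegral_tsum fun n => (hgm n).aemeasurable]
    refine ne_top_of_le_ne_top ?_ (ENNReal.tsum_le_tsum fun n => (hqlt n).le)
    rw [← ENNReal.ofReal_tsum_of_nonneg (fun n => by positivity) summable_geometric_two]
    exact ENNReal.ofReal_ne_top
  have hlim : ∀ᵐ x ∂(M.law 0), Filter.Tendsto (fun n => ENNReal.ofReal (q n x)) Filter.atTop
      (nhds (ENNReal.ofReal (M.fullCond 0 j x))) := by
    filter_upwards [ae_lt_top (Measurable.tsum hgm) hsum, M.ae_normalizer_ne_top 0 j]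
      with x hx hx'
    have hp := M.fullCond_pos hpos hx'
    have h1 := (ENNReal.tendsto_toReal ENNReal.zero_ne_top).comp
      (ENNReal.tendsto_atTop_zero_of_tsum_ne_top hx.ne)
    have h2 : Filter.Tendsto (fun n => (1 - √(q n x / M.fullCond 0 j x)) ^ 2) Filter.atTop
        (nhds 0) := by
      refine h1.congr fun n => ?_
      simp only [Function.comp_apply]
      exact ENNReal.toReal_ofReal (sq_nonneg _)
    have h3 : Filter.Tendsto (fun n => |1 - √(q n x / M.fullCond 0 j x)|) Filter.atTop
        (nhds 0) := by
      have := h2.sqrt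
      simpa only [Real.sqrt_sq_eq_abs, Real.sqrt_zero] using this
    have h4 := (tendsto_zero_iff_abs_tendsto_zero _).mpr h3
    have h5 : Filter.Tendsto (fun n => (1 - (1 - √(q n x / M.fullCond 0 j x))) ^ 2 *
        M.fullCond 0 j x) Filter.atTop (nhds ((1 - 0) ^ 2 * M.fullCond 0 j x)) :=
      ((h4.const_sub 1).pow 2).mul_const _
    refine ENNReal.tendsto_ofReal ?_
    convert h5 using 2 with n
    · rw [sub_sub_cancel, Real.sq_sqrt (div_nonneg (hqpos n x).le hp.le), div_mul_cancel₀ _ hp.ne']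
    · ring
  refine hS (boundary_subset_of_condIndepVars M.acyclic hfaithful hj
    (M.condIndepVars_of_fullCond_ae_eq hpos hj
      -- The limsup exists at every point, so it depends on `insert j S` everywhere, not just up to
      -- a null set.
      (q := fun x => Filter.limsup (fun n => ENNReal.ofReal (q n x)) Filter.atTop)
      (Measurable.limsup fun n => (hqm n).ennreal_ofReal) ?_ ?_))
  · intro x y hxy
    simp only [fun n => hqS n hxy]
  · filter_upwards [hlim] with x hx using hx.limsup_eq.symm

end CausalModel

end Gaps
-- From gaps at single variables to the optimization problems
section Scores

theorem coe_ereal_sum {ι : Type*} (s : Finset ι) (f : ι → ℝ) :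
    ((∑ i ∈ s, f i : ℝ) : EReal) = ∑ i ∈ s, (f i : EReal) := by
  classical
  induction s using Finset.induction_on with
  | empty => simp
  | insert a s ha ih => rw [Finset.sum_insert ha, Finset.sum_insert ha, EReal.coe_add, ih]

theorem edgeCount_eq_sum {V : Type*} [Fintype V] (G : Digraph V) :
    edgeCount G = ∑ j, (parents G j).ncard := by
  classical
  simp only [edgeCount, parents, Set.ncard_eq_toFinset_card', Set.toFinset_ofPred,
    Finset.card_filter]
  exact Fintype.sum_prod_type_right _

/-- A finite minimum of thresholds, phrased with a filter so that an empty `ι` needs no separate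
case. -/
theorem exists_pos_forall_le {ι : Type*} [Finite ι] {p : ι → ℝ → Prop}
    (h : ∀ i, ∃ δ, 0 < δ ∧ ∀ ε, ε ≤ δ → p i ε) : ∃ δ, 0 < δ ∧ ∀ i, p i δ := by
  choose δ hδ hp using h
  have h1 : ∀ᶠ ε in nhdsWithin (0 : ℝ) (Set.Ioi 0), ∀ i, ε ≤ δ i :=
    Filter.eventually_all.mpr fun i => nhdsWithin_le_nhds (Iic_mem_nhds (hδ i))
  obtain ⟨ε, hε, hε0⟩ := (h1.and self_mem_nhdsWithin).exists
  exact ⟨ε, hε0, fun i => hp i ε (hε i)⟩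

namespace ModelClass

variable {V : Type*} [Fintype V] [DecidableEq V] {X : V → Type*} [∀ i, MeasurableSpace (X i)]
  {μ : ∀ i, Measure (X i)} {K : ℕ} {target : Fin (K + 1) → Finset V} {Θ : Type*}

omit [Fintype V] in
theorem dens_lintegral (N : ModelClass X μ K target Θ) (θ : Θ) (k : Fin (K + 1)) (j : V)
    (x : ∀ i, X i) :
    ∫⁻ t, ENNReal.ofReal (N.dens θ k j (Function.update x j t)) ∂(μ j) = 1 := by
  have h1 := N.dens_integral θ k j x
  have hi : Integrable (fun t => N.dens θ k j (Function.update x j t)) (μ j) := by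
    by_contra hn
    rw [integral_undef hn] at h1
    exact zero_ne_one h1
  rw [← ofReal_integral_eq_lintegral_ofReal hi (ae_of_all _ fun t => N.dens_nonneg θ k j _), h1,
    ENNReal.ofReal_one]

theorem dens_dependsOn (N : ModelClass X μ K target Θ) (θ : Θ) (j : V) :
    DependsOn (N.dens θ 0 j) (insert j (parents (N.graph θ) j)) := by
  refine dependsOn_of_forall_update fun l hl => ?_
  by_contra h
  exact hl (Or.inr ⟨fun e => hl (Or.inl e), h⟩)

omit [Fintype V] in
theorem graph_loopless (N : ModelClass X μ K target Θ) (θ : Θ) : Loopless (N.graph θ) :=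
  fun _ h => h.1 rfl

omit [Fintype V] in
theorem nodeLik_le (N : ModelClass X μ K target Θ) {P : Fin (K + 1) → Measure (∀ i, X i)}
    {w : Fin (K + 1) → ℝ} (hw : ∀ k, 0 ≤ w k) {j : V} {θ : Θ} {ℓ : Fin (K + 1) → ℝ}
    (h : ∀ k, j ∉ target k → expect (P k) (fun x => Real.log (N.dens θ k j x)) ≤ ℓ k) :
    N.nodeLik P w j θ ≤ ((∑ k with j ∉ target k, w k * ℓ k : ℝ) : EReal) := by
  rw [nodeLik, coe_ereal_sum]
  refine Finset.sum_le_sum fun k hk => ?_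
  rw [EReal.coe_mul]
  exact mul_le_mul_of_nonneg_left (h k (Finset.mem_filter.mp hk).2)
    (EReal.coe_nonneg.mpr (hw k))

omit [Fintype V] in
theorem nodeLik_eq (N : ModelClass X μ K target Θ) {P : Fin (K + 1) → Measure (∀ i, X i)}
    {w : Fin (K + 1) → ℝ} {j : V} {θ : Θ} {ℓ : Fin (K + 1) → ℝ}
    (h : ∀ k, j ∉ target k → expect (P k) (fun x => Real.log (N.dens θ k j x)) = ℓ k) :
    N.nodeLik P w j θ = ((∑ k with j ∉ target k, w k * ℓ k : ℝ) : EReal) := by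
  rw [nodeLik, coe_ereal_sum]
  refine Finset.sum_congr rfl fun k hk => ?_
  rw [EReal.coe_mul, h k (Finset.mem_filter.mp hk).2]

/-- If for every variable the penalized likelihood drops by at least `lam` below a value `T j`
that some parameter with graph `B` attains as soon as the parents are not those in `B`, then `B`
is the unique solution of all three optimization problems. -/
theorem solutions_of_gap (N : ModelClass X μ K target Θ) (P : Fin (K + 1) → Measure (∀ i, X i))
    (w : Fin (K + 1) → ℝ) {lam : ℝ} (hlam : 0 < lam) {B : Digraph V} (T : V → ℝ)
    (hle : ∀ θ j, N.nodeLik P w j θ ≤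
      ((T j + lam * (parents (N.graph θ) j).ncard : ℝ) : EReal))
    (hlt : ∀ θ j, parents (N.graph θ) j ≠ parents B j → N.nodeLik P w j θ ≤
      ((T j + lam * (parents (N.graph θ) j).ncard - lam : ℝ) : EReal))
    {θ₀ : Θ} (hgraph : N.graph θ₀ = B)
    (heq : ∀ j, N.nodeLik P w j θ₀ = ((T j + lam * (parents B j).ncard : ℝ) : EReal)) :
    (∃ θ, N.IsSolution P w lam θ) ∧ (∀ θ, N.IsSolution P w lam θ → N.graph θ = B) ∧
      (∀ G, N.IsSolutionGraph P w lam G ↔ G = B) ∧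
      ∀ j S, N.IsSolutionParents P w lam j S ↔ S = parents B j := by
  classical
  have hB : Loopless B := hgraph ▸ N.graph_loopless θ₀
  have hscore : ∀ θ, N.score P w lam θ ≤
      ((∑ j, T j - if N.graph θ = B then 0 else lam : ℝ) : EReal) := by
    intro θ
    have h1 : ∀ j, N.nodeLik P w j θ ≤ ((T j + lam * (parents (N.graph θ) j).ncard -
        if parents (N.graph θ) j = parents B j then 0 else lam : ℝ) : EReal) := by
      intro j
      split_ifs with h
      · simpa using hle θ j
      · exact hlt θ j h
    -- A graph other than `B` has a different parent set at some variable, and that one variable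
    -- already loses `lam`.
    have h2 : (if N.graph θ = B then 0 else lam) ≤
        ∑ j, if parents (N.graph θ) j = parents B j then 0 else lam := by
      have h0 : ∀ j ∈ Finset.univ,
          0 ≤ if parents (N.graph θ) j = parents B j then 0 else lam := by
        intro j _
        split_ifs
        exacts [le_rfl, hlam.le]
      split_ifs with h
      · exact Finset.sum_nonneg h0
      · obtain ⟨j, hj⟩ : ∃ j, parents (N.graph θ) j ≠ parents B j := by
          by_contra! hcon
          refine h (Digraph.ext ?_)
          funext i j
          exact congrArg (i ∈ ·) (hcon j)
        refine le_trans ?_ (Finset.single_le_sum h0 (Finset.mem_univ j))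
        rw [if_neg hj]
    refine (EReal.sub_le_sub (Finset.sum_le_sum fun j _ => h1 j) le_rfl).trans ?_
    rw [← coe_ereal_sum, ← EReal.coe_sub, EReal.coe_le_coe_iff, edgeCount_eq_sum]
    push_cast
    rw [Finset.sum_sub_distrib, Finset.sum_add_distrib, ← Finset.mul_sum]
    linarith
  have hscore₀ : N.score P w lam θ₀ = ((∑ j, T j : ℝ) : EReal) := by
    rw [score, Finset.sum_congr rfl fun j _ => heq j, ← coe_ereal_sum, ← EReal.coe_sub,
      hgraph, edgeCount_eq_sum, EReal.coe_eq_coe_iff]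
    push_cast
    rw [Finset.sum_add_distrib, ← Finset.mul_sum, add_sub_cancel_right]
  have hscore_le : ∀ θ, N.score P w lam θ ≤ N.score P w lam θ₀ := by
    intro θ
    rw [hscore₀]
    refine (hscore θ).trans (EReal.coe_le_coe_iff.mpr ?_)
    split_ifs <;> linarith
  have hgs₀ : N.score P w lam θ₀ ≤ N.graphScore P w lam B := le_iSup₂_of_le θ₀ hgraph le_rfl
  have hps₀ : ∀ j, ((T j : ℝ) : EReal) ≤ N.parentScore P w lam j (parents B j) := by
    intro j
    refine le_iSup₂_of_le θ₀ (by rw [hgraph]) ?_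
    rw [heq, ← EReal.coe_sub, add_sub_cancel_right]
  refine ⟨⟨θ₀, N.graph_loopless θ₀, fun θ _ => hscore_le θ⟩, fun θ hθ => ?_, fun G => ⟨?_, ?_⟩,
    fun j S => ⟨?_, ?_⟩⟩
  · by_contra hne
    have h1 := (hθ.2 θ₀ (N.graph_loopless θ₀)).trans (hscore θ)
    rw [hscore₀, if_neg hne, EReal.coe_le_coe_iff] at h1
    linarith
  · intro hG
    by_contra hne
    have h1 : N.graphScore P w lam G ≤ ((∑ j, T j - lam : ℝ) : EReal) := by
      refine iSup₂_le fun θ hθ => (hscore θ).trans ?_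
      rw [if_neg (hθ ▸ hne)]
    have h2 := hgs₀.trans ((hG.2 B hB).trans h1)
    rw [hscore₀, EReal.coe_le_coe_iff] at h2
    linarith
  · rintro rfl
    exact ⟨hB, fun G' _ => iSup₂_le fun θ _ => (hscore_le θ).trans hgs₀⟩
  · intro hS
    by_contra hne
    have h1 : N.parentScore P w lam j S ≤ ((T j - lam : ℝ) : EReal) := by
      refine iSup₂_le fun θ hθ => ?_
      refine (EReal.sub_le_sub (hlt θ j (hθ ▸ hne)) le_rfl).trans ?_
      rw [← EReal.coe_sub, EReal.coe_le_coe_iff, hθ]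
      linarith
    have h2 := (hps₀ j).trans ((hS.2 (parents B j) (hB j)).trans h1)
    rw [EReal.coe_le_coe_iff] at h2
    linarith
  · rintro rfl
    refine ⟨hB j, fun S' _ => iSup₂_le fun θ hθ => ?_⟩
    refine (EReal.sub_le_sub (hle θ j) le_rfl).trans (le_trans ?_ (hps₀ j))
    rw [← EReal.coe_sub, EReal.coe_le_coe_iff, hθ]
    linarith

end ModelClass

end Scores

/-! ### Boundaries, the true parameter and the uniform gap -/

section Recovery

variable {V : Type*} [Fintype V] [DecidableEq V] {X : V → Type*} [∀ i, MeasurableSpace (X i)]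
  {μ : ∀ i, Measure (X i)} [∀ i, SigmaFinite (μ i)] [∀ i, Nonempty (X i)]
  [∀ i, StandardBorelSpace (X i)] {K : ℕ}

namespace CausalModel

theorem isMarkovBlanket_boundary (M : CausalModel X μ K) (hpos : ∀ x, 0 < M.joint 0 x) (j : V) :
    IsMarkovBlanket (M.law 0) j (boundary M.graph j) := by
  have hj : j ∉ boundary M.graph j := fun h => h.2 rfl
  refine ⟨hj, M.condIndepVars_of_fullCond_ae_eq hpos hj
    (M.fullCond_measurable 0 j).ennreal_ofReal (fun x y hxy => ?_) (ae_of_all _ fun _ => rfl)⟩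
  simp only [M.fullCond_dependsOn hpos j hxy]

theorem isMarkovBoundary_iff (M : CausalModel X μ K) (hpos : ∀ x, 0 < M.joint 0 x)
    (hfaithful : Faithful (M.law 0) M.graph) (j : V) (S : Set V) :
    IsMarkovBoundary (M.law 0) j S ↔ S = boundary M.graph j := by
  have hb := M.isMarkovBlanket_boundary hpos j
  have hmin : ∀ S, IsMarkovBlanket (M.law 0) j S → boundary M.graph j ⊆ S := fun S hS =>
    boundary_subset_of_condIndepVars M.acyclic hfaithful hS.1 hS.2
  constructor
  · intro hS
    exact (hS.2 hb (hmin S hS.1)).antisymm (hmin S hS.1)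
  · rintro rfl
    exact ⟨hb, fun S hS _ => hmin S hS⟩

/-- No edge is superfluous, since the true conditional involves only the boundary; none is missing,
since the parents that `θ` induces form a blanket. -/
theorem graph_eq_boundaryGraph (M : CausalModel X μ K) (hpos : ∀ x, 0 < M.joint 0 x)
    (hfaithful : Faithful (M.law 0) M.graph) {Θ : Type*} (N : ModelClass X μ K M.target Θ) {θ : Θ}
    (hθ : ∀ j x, N.dens θ 0 j x = M.fullCond 0 j x) : N.graph θ = boundaryGraph M.graph := by
  refine Digraph.ext ?_
  funext l j
  refine propext ⟨fun h => ?_, fun h => ?_⟩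
  · by_contra hl
    refine h.2 fun x t => ?_
    rw [hθ, hθ]
    refine M.fullCond_dependsOn hpos j fun i hi => Function.update_of_ne ?_ _ _
    rintro rfl
    exact hi.elim h.1 hl
  · have hj : j ∉ parents (N.graph θ) j := N.graph_loopless θ j
    exact boundary_subset_of_condIndepVars M.acyclic hfaithful hj
      (M.condIndepVars_of_fullCond_ae_eq hpos hj
        (q := fun x => ENNReal.ofReal (N.dens θ 0 j x)) (N.dens_measurable θ 0 j).ennreal_ofReal
        (fun x y hxy => by simp only [N.dens_dependsOn θ j hxy])
        (ae_of_all _ fun x => by simp only [hθ])) h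

/-- There is a positive lower bound on the loss in expected log-likelihood of all observational
conditional densities whose parents miss an element of the boundary. -/
theorem exists_uniform_gap (M : CausalModel X μ K) (hpos : ∀ x, 0 < M.joint 0 x)
    (hfaithful : Faithful (M.law 0) M.graph)
    (hint : ∀ j, Integrable (fun x => Real.log (M.fullCond 0 j x)) (M.law 0)) :
    ∃ δ : ℝ, 0 < δ ∧ ∀ (Θ : Type*) (N : ModelClass X μ K M.target Θ),
      (∀ θ k j x, 0 < N.dens θ k j x) → ∀ θ j,
      ¬ boundary M.graph j ⊆ parents (N.graph θ) j →
      expect (M.law 0) (fun x => Real.log (N.dens θ 0 j x)) ≤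
        ((∫ x, Real.log (M.fullCond 0 j x) ∂(M.law 0) - δ : ℝ) : EReal) := by
  -- The gap is taken over pairs `(j, S)` and all densities depending on `insert j S`, so it does
  -- not see the model class. Pairs without content get the value 1.
  obtain ⟨δ, hδ, h⟩ := exists_pos_forall_le (ι := V × Set V)
    (p := fun i δ => i.1 ∉ i.2 → ¬ boundary M.graph i.1 ⊆ i.2 → ∀ q : (∀ i, X i) → ℝ,
      Measurable q → (∀ x, 0 < q x) → DependsOn q (insert i.1 i.2) → ENNReal.ofReal δ ≤
        ∫⁻ x, ENNReal.ofReal ((1 - √(q x / M.fullCond 0 i.1 x)) ^ 2) ∂(M.law 0)) (by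
    rintro ⟨j, S⟩
    by_cases hj : j ∈ S
    · exact ⟨1, one_pos, fun _ _ h => absurd hj h⟩
    by_cases hS : boundary M.graph j ⊆ S
    · exact ⟨1, one_pos, fun _ _ _ h => absurd hS h⟩
    obtain ⟨δ, hδ, h⟩ := M.exists_hellinger_gap hpos hfaithful hj hS
    exact ⟨δ, hδ, fun ε hε _ _ q h1 h2 h3 =>
      (ENNReal.ofReal_le_ofReal hε).trans (h q h1 h2 h3)⟩)
  refine ⟨δ, hδ, fun Θ N hN θ j hb => ?_⟩
  exact M.expect_log_le hpos (hint j) (N.dens_measurable θ 0 j) (hN θ 0 j)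
    (N.dens_lintegral θ 0 j) (h (j, parents (N.graph θ) j) (N.graph_loopless θ j) hb _
      (N.dens_measurable θ 0 j) (hN θ 0 j) (N.dens_dependsOn θ j))

end CausalModel

end Recovery
end CausalStage

/-! ### The main theorem -/

open CausalStage in
theorem theorem5 {V : Type*} [Fintype V] [DecidableEq V] {X : V → Type*}
    [∀ i, MeasurableSpace (X i)] [∀ i, StandardBorelSpace (X i)] [∀ i, Nonempty (X i)]
    (μ : ∀ i, Measure (X i)) [∀ i, SigmaFinite (μ i)] (K : ℕ) (M : CausalModel X μ K)
    (w : Fin (K + 1) → ℝ) (hw : ∀ k, 0 ≤ w k) (hw_sum : ∑ k, w k = 1) (hw_zero : 0 < w 0)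
    (hpos : ∀ k x, 0 < M.joint k x)
    (hfaithful : Faithful (M.law 0) M.graph)
    (hfinite : ∀ k j, j ∉ M.target k →
      Integrable (fun x => Real.log (M.fullCond k j x)) (M.law k)) :
    (∀ j S, IsMarkovBoundary (M.law 0) j S ↔ S = boundary M.graph j) ∧
    ∃ lam₀ : ℝ, 0 < lam₀ ∧
      ∀ (Θ : Type*) (N : ModelClass X μ K M.target Θ),
        (∀ θ k j x, 0 < N.dens θ k j x) → Expresses M N →
        ∀ lam : ℝ, 0 < lam → lam < lam₀ →
          (∃ θ, N.IsSolution M.law w lam θ) ∧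
          (∀ θ, N.IsSolution M.law w lam θ → ∀ j,
            parents (N.graph θ) j = boundary M.graph j ∧
            parents M.graph j ⊆ parents (N.graph θ) j) ∧
          (∀ G, N.IsSolutionGraph M.law w lam G ↔ G = boundaryGraph M.graph) ∧
          (∀ j S, N.IsSolutionParents M.law w lam j S ↔ S = boundary M.graph j) := by
  have htarget : ∀ j, j ∉ M.target 0 := fun j => by simp [M.target_zero]
  refine ⟨M.isMarkovBoundary_iff (hpos 0) hfaithful, ?_⟩
  obtain ⟨δ, hδ, hgap⟩ := M.exists_uniform_gap (hpos 0) hfaithful fun j => hfinite 0 j (htarget j)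
  -- Dropping parents saves at most `lam * card V`; the extra 1 leaves the margin `lam` that
  -- `solutions_of_gap` requires.
  refine ⟨w 0 * δ / (Fintype.card V + 1), by positivity, ?_⟩
  rintro Θ N hN ⟨θ₀, hθ₀⟩ lam hlam hlam₀
  rw [lt_div_iff₀ (by positivity)] at hlam₀
  let ℓ : V → Fin (K + 1) → ℝ := fun j k => ∫ x, Real.log (M.fullCond k j x) ∂(M.law k)
  let L : V → ℝ := fun j => ∑ k with j ∉ M.target k, w k * ℓ j k
  have hgraph := M.graph_eq_boundaryGraph (hpos 0) hfaithful N (θ := θ₀)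
    fun j x => hθ₀ 0 j (htarget j) x
  have hℓ : ∀ θ j k, j ∉ M.target k →
      expect (M.law k) (fun x => Real.log (N.dens θ k j x)) ≤ ((ℓ j k : ℝ) : EReal) := by
    intro θ j k hk
    -- With `δ = 0` this is Gibbs' inequality.
    have h := M.expect_log_le (hpos k) (hfinite k j hk) (N.dens_measurable θ k j) (hN θ k j)
      (N.dens_lintegral θ k j) (δ := 0) (by simp)
    simpa using h
  have hL : ∀ θ j, N.nodeLik M.law w j θ ≤ ((L j : ℝ) : EReal) := fun θ j =>
    N.nodeLik_le hw (hℓ θ j)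
  have hLδ : ∀ θ j, ¬ boundary M.graph j ⊆ parents (N.graph θ) j →
      N.nodeLik M.law w j θ ≤ ((L j - w 0 * δ : ℝ) : EReal) := by
    intro θ j hb
    -- Only regime 0 is charged with the loss; no variable is a target there and its weight is
    -- positive.
    refine (N.nodeLik_le (ℓ := fun k => ℓ j k - if k = 0 then δ else 0) hw
      fun k hk => ?_).trans (le_of_eq ?_)
    · split_ifs with h0
      · subst h0
        exact hgap Θ N hN θ j hb
      · simpa using hℓ θ j k hk
    · simp only [mul_sub, Finset.sum_sub_distrib, L]
      congr 2
      simp [htarget]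
  have hL₀ : ∀ j, N.nodeLik M.law w j θ₀ = ((L j : ℝ) : EReal) := fun j =>
    N.nodeLik_eq fun k hk => by
      simp only [hθ₀ k j hk]
      exact expect_eq_integral (hfinite k j hk)
  have hcard : ∀ S : Set V, (S.ncard : ℝ) ≤ Fintype.card V := fun S => by
    rw [← Nat.card_eq_fintype_card]
    exact_mod_cast Set.ncard_le_card S
  have key : ∀ θ j, parents (N.graph θ) j ≠ boundary M.graph j → N.nodeLik M.law w j θ ≤
      ((L j - lam * (boundary M.graph j).ncard + lam * (parents (N.graph θ) j).ncard - lam : ℝ) :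
        EReal) := by
    intro θ j hne
    by_cases hb : boundary M.graph j ⊆ parents (N.graph θ) j
    · refine (hL θ j).trans (EReal.coe_le_coe_iff.mpr ?_)
      -- A strict superset of the boundary pays for at least one more edge, with no gain in
      -- likelihood.
      have h1 : ((boundary M.graph j).ncard : ℝ) + 1 ≤ (parents (N.graph θ) j).ncard := by
        exact_mod_cast Set.ncard_lt_ncard (hb.ssubset_of_ne hne.symm)
      nlinarith
    · refine (hLδ θ j hb).trans (EReal.coe_le_coe_iff.mpr ?_)
      have h1 := mul_le_mul_of_nonneg_left (hcard (boundary M.graph j)) hlam.le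
      have h2 : 0 ≤ lam * ((parents (N.graph θ) j).ncard : ℝ) := by positivity
      linarith
  obtain ⟨h1, h2, h3, h4⟩ := N.solutions_of_gap M.law w hlam (B := boundaryGraph M.graph)
    (fun j => L j - lam * (boundary M.graph j).ncard) (fun θ j => by
      by_cases h : parents (N.graph θ) j = boundary M.graph j
      · simpa [h] using hL θ j
      · refine (key θ j h).trans (EReal.coe_le_coe_iff.mpr ?_)
        linarith) key hgraph (fun j => by
      rw [hL₀]
      congr 1
      exact (sub_add_cancel _ _).symm)
  refine ⟨h1, fun θ hθ j => ?_, h3, h4⟩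
  rw [h2 θ hθ]
  refine ⟨rfl, fun i hi => ⟨Or.inl (Or.inl hi), ?_⟩⟩
  rintro rfl
  exact M.acyclic i (Relation.TransGen.single hi)
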